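/- Let $\mathbb K$ be an algebraically closed field of characteristic $0$, let $p\in\mathbb K[x,y]$ be irreducible with $p\notin\mathbb K[x]\cup\mathbb K[y]$, and let $\mathbb K[x,y]_p$ be the ring of rational functions in $\mathbb K(x,y)$ whose reduced denominator is not divisible by $p$. Let $r\in\mathbb K[x,y]_p$, $f\in\mathbb K(x)$ and $g\in\mathbb K(y)$ be such that $r+qp=f-g$ for some $q\in\mathbb K[x,y]_p$. For $h\in\mathbb K(z)\setminus\{0\}$ and $s\in\mathbb P^1(\mathbb K)=\mathbb K\cup\{\infty\}$ let $\mathrm m(s,h)$ be the negative of the order of vanishing of $h$ at $s$ (so $\mathrm m(\infty,h)=\deg h$); $s$ is a pole of $h$ if $\mathrm m(s,h)>0$, and $\mathrm m(s,h)$ is then its multiplicity. The function $0$ has no poles. The curve associated with $p$ is the zero set $C\subset\mathbb P^1(\mathbb K)\times\mathbb P^1(\mathbb K)$ of the bi-homogenization $x_0^{\deg_x p}y_0^{\deg_y p}p(x_1/x_0,y_1/y_0)$. For a pair $T$ of Möbius transformations of the two factors of $\mathbb P^1(\mathbb K)\times\mathbb P^1(\mathbb K)$ let $p_T$ be the numerator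 of $p\circ T^{-1}$ and $r_T=r\circ T^{-1}$. Let $\mathbb K\{\{x^{-1}\}\}$ be the field of Puiseux series in $x^{-1}$ over $\mathbb K$, and let $\deg$ be the largest exponent of such a series as a series in $x$, with $\deg 0=-\infty$. For a point $(s_1,s_2)$, a branch at $(s_1,s_2)$ is a pair $(T,\varphi)$ of such a $T$ with $T(s_1,s_2)=(\infty,\infty)$ and a $\varphi\in\mathbb K\{\{x^{-1}\}\}$ with $p_T(x,\varphi)=0$ and $\deg\varphi>0$. The point $(s_1,s_2)$ is a pole of $r$ if $\deg r_T(x,\varphi)>0$ for some branch $(T,\varphi)$ at $(s_1,s_2)$. Let $(s_1,s_2)\in C$. Then for every $T$ with $T(s_1,s_2)=(\infty,\infty)$ there is a branch $(T,\varphi)$ at $(s_1,s_2)$, and the following hold. 1. If $(s_1,s_2)$ is a pole of $r$, then $s_1$ is a pole of $f$ or $s_2$ is a pole of $g$. 2. If $s_1$ is a pole of $f$ but $s_2$ is not a pole of $g$, then $\mathrm m(s_1,f)=\deg r_T(x,\varphi)$ for every branch $(T,\varphi)$ at $(s_1,s_2)$. If $s_2$ is a pole of $g$ but $s_1$ is not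 a pole of $f$, then $\mathrm m(s_2,g)=\deg r_T(x,\varphi)/\deg\varphi$ for every branch $(T,\varphi)$ at $(s_1,s_2)$. 3. If $(s_1,s_2)$ is not a pole of $r$, then $s_1$ is a pole of $f$ if and only if $s_2$ is a pole of $g$. 4. If $(s_1,s_2)$ is not a pole of $r$, and $s_1$ and $s_2$ are poles of $f$ and $g$, respectively, then $\mathrm m(s_2,g)=\mathrm m(s_1,f)/\deg\varphi$ for every branch $(T,\varphi)$ at $(s_1,s_2)$. -/

import Mathlib

open OnePoint

namespace SepCurve

noncomputable section

/-- `K[x, y]`, with `x` and `y` the variables of index `0` and `1`. -/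
abbrev Poly2 (K : Type*) [Field K] : Type _ := MvPolynomial (Fin 2) K

/-- `K(x, y)`. -/
abbrev Rat2 (K : Type*) [Field K] : Type _ := FractionRing (Poly2 K)

/-- Numerator of a rational function in reduced form. -/
def num {K : Type*} [Field K] (r : Rat2 K) : Poly2 K := IsFractionRing.num (Poly2 K) r

/-- Denominator of a rational function in reduced form. -/
def den {K : Type*} [Field K] (r : Rat2 K) : Poly2 K := (IsFractionRing.den (Poly2 K) r : Poly2 K)

/-- The element `x` of `K(x, y)`. -/
def xx (K : Type*) [Field K] : Rat2 K := algebraMap (Poly2 K) (Rat2 K) (MvPolynomial.X 0)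

/-- The element `y` of `K(x, y)`. -/
def yy (K : Type*) [Field K] : Rat2 K := algebraMap (Poly2 K) (Rat2 K) (MvPolynomial.X 1)

/-- The local ring `K[x, y]_p`: rational functions whose denominator is not divisible by `p`. -/
def InLocalRing {K : Type*} [Field K] (p : Poly2 K) (r : Rat2 K) : Prop := ¬ p ∣ den r

/-- The set `F(r, p)` of all pairs `(f, g)` in `K(x) × K(y)` such that `f - g = r + q p` for some
`q` in the local ring `K[x, y]_p`. -/
def sepSet {K : Type*} [Field K] (r : Rat2 K) (p : Poly2 K) : Set (RatFunc K × RatFunc K) :=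
  {fg | ∃ q : Rat2 K, InLocalRing p q ∧
    r + q * algebraMap (Poly2 K) (Rat2 K) p =
      RatFunc.eval (algebraMap K (Rat2 K)) (xx K) fg.1 -
        RatFunc.eval (algebraMap K (Rat2 K)) (yy K) fg.2}

/-- The value `m(s, f)`: minus the valuation of `f` at the point `s` of the projective line, so
the pole order at a finite point (negative at a zero) and the degree at infinity.
(The zero function, whose value should be `-∞`, gets `0`; only positive values matter below.) -/
def mult {K : Type*} [Field K] (s : OnePoint K) (f : RatFunc K) : ℤ :=
  s.elim f.intDegree
    (fun a => (f.denom.rootMultiplicity a : ℤ) - (f.num.rootMultiplicity a : ℤ))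

/-- `s` is a pole of the univariate rational function `f`. -/
def IsPole {K : Type*} [Field K] (s : OnePoint K) (f : RatFunc K) : Prop := 0 < mult s f

/-- Homogeneous coordinates `(s₀, s₁)` of a point of the projective line: `(1, s)` if the point `s`
is finite and `(0, 1)` if it is infinite. -/
def homCoord {K : Type*} [Field K] (s : OnePoint K) : K × K := s.elim (0, 1) (fun a => (1, a))

/-- The value at `((x₀, x₁), (y₀, y₁))` of the bi-homogenization
`x₀ ^ deg_x p * y₀ ^ deg_y p * p (x₁ / x₀, y₁ / y₀)` of `p`. -/
def biHom {K : Type*} [Field K] (p : Poly2 K) (x y : K × K) : K :=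
  ∑ m ∈ p.support, p.coeff m *
    (x.1 ^ (p.degreeOf 0 - m 0) * x.2 ^ m 0) * (y.1 ^ (p.degreeOf 1 - m 1) * y.2 ^ m 1)

/-- `(s₁, s₂)` lies on the curve in `ℙ¹ × ℙ¹` associated with `p`. -/
def OnCurve {K : Type*} [Field K] (p : Poly2 K) (s₁ s₂ : OnePoint K) : Prop :=
  biHom p (homCoord s₁) (homCoord s₂) = 0

/-- The value of a rational function `r` in two variables at a pair `(a, b)` of elements of an
extension field. -/
def evalRat {K : Type*} [Field K] {L : Type*} [Field L] [Algebra K L] (a b : L) (r : Rat2 K) : L :=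
  MvPolynomial.aeval ![a, b] (num r) / MvPolynomial.aeval ![a, b] (den r)

/-- The Möbius transformation with matrix `A`, applied to an element of an extension field. -/
def moebius {K : Type*} [Field K] {L : Type*} [Field L] [Algebra K L] (A : GL (Fin 2) K) (z : L) :
    L :=
  (algebraMap K L (A 0 0) * z + algebraMap K L (A 0 1)) /
    (algebraMap K L (A 1 0) * z + algebraMap K L (A 1 1))

/-- `r ∘ T⁻¹`, where `T` acts on the first coordinate by the Möbius transformation with matrix `A`
and on the second coordinate by that with matrix `B`. -/
def transRat {K : Type*} [Field K] (A B : GL (Fin 2) K) (r : Rat2 K) : Rat2 K :=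
  evalRat (moebius A⁻¹ (xx K)) (moebius B⁻¹ (yy K)) r

/-- The numerator of `p ∘ T⁻¹`, for `T` as in `transRat`. -/
def transPoly {K : Type*} [Field K] (A B : GL (Fin 2) K) (p : Poly2 K) : Poly2 K :=
  num (MvPolynomial.aeval ![moebius A⁻¹ (xx K), moebius B⁻¹ (yy K)] p)

/-- A Puiseux series in (positive powers of) `t`: a Hahn series with rational exponents that have
a common denominator. Here `t` stands for `x⁻¹`; Puiseux series form a subfield of the field
`HahnSeries ℚ K`, in which all computations take place. -/
def IsPuiseux {K : Type*} [Field K] (φ : HahnSeries ℚ K) : Prop :=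
  ∃ n : ℕ, 0 < n ∧ ∀ a ∈ φ.support, ∃ m : ℤ, a * n = m

/-- The series `x = t⁻¹`. -/
def xSer (K : Type*) [Field K] : HahnSeries ℚ K := HahnSeries.single (-1) 1

/-- The degree in `x = t⁻¹` of a series in `t`, that is, its largest exponent as a series in `x`.
(The zero series, whose degree should be `-∞`, gets `0`; only positive values matter below.) -/
def degSer {K : Type*} [Field K] (φ : HahnSeries ℚ K) : ℚ := -φ.order

/-- `φ` is a Puiseux series in `x⁻¹` with `p(x, φ) = 0` and `deg φ > 0`: a branch at `(∞, ∞)` of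
the curve associated with `p`. -/
def IsBranch {K : Type*} [Field K] (p : Poly2 K) (φ : HahnSeries ℚ K) : Prop :=
  IsPuiseux φ ∧ MvPolynomial.aeval ![xSer K, φ] p = 0 ∧ 0 < degSer φ

/-- `(∞, ∞)` is a pole of `r` on the curve associated with `p`. -/
def IsPoleAtInfty {K : Type*} [Field K] (p : Poly2 K) (r : Rat2 K) : Prop :=
  ∃ φ : HahnSeries ℚ K, IsBranch p φ ∧ 0 < degSer (evalRat (xSer K) φ r)

/-- `(s₁, s₂)` is a pole of `r` on the curve associated with `p`: some transformation `T` of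
`ℙ¹ × ℙ¹` maps `(s₁, s₂)` to `(∞, ∞)`, and the latter is a pole of `r ∘ T⁻¹` on the curve
associated with the numerator of `p ∘ T⁻¹`. -/
def IsPoleOnCurve {K : Type*} [Field K] [DecidableEq K] (p : Poly2 K) (r : Rat2 K)
    (s₁ s₂ : OnePoint K) : Prop :=
  ∃ A B : GL (Fin 2) K, A • s₁ = ∞ ∧ B • s₂ = ∞ ∧
    IsPoleAtInfty (transPoly A B p) (transRat A B r)

end

end SepCurve

open SepCurve

/-!
Along a branch `(T, φ)` the equation `r + q p = f - g` loses the term `q p`: the substitution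
`(x, y) = T⁻¹(x, φ)` makes sense in `K[x, y]_p` because both coordinates are transcendental over
`K` and annihilate `p`. So `r_T(x, φ) = u - v`, where `u` and `v` are the values of `f` and `g` at
Möbius transforms of `x` and `φ`. A Möbius transform of an element of positive degree approaches
`s₁` resp. `s₂` to exactly that degree, whence `deg u = m(s₁, f)` and `deg v = m(s₂, g) deg φ`, and
everything is read off from the ultrametric inequality for `u - v`.

Branches exist by the Newton–Puiseux theorem, applied to the local equation of the curve at
`(s₁, s₂)` in the coordinates `1 / x` and `1 / y`. Irreducibility of `p` and `p ∉ K[x] ∪ K[y]` keep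
`1 / x = 0` and `1 / y = 0` from being components of the curve.
-/

namespace SepCurve

noncomputable section

universe u

section NewtonPuiseux

open Polynomial
open scoped PowerSeries

theorem exists_unit_isRoot_of_coeff_mem {R : Type*} [CommRing R] {I : Ideal R} [HenselianRing R I]
    (P : R[X]) (h0 : P.coeff 0 = 1) (h1 : IsUnit (P.coeff 1)) (h2 : ∀ i, P.coeff (i + 2) ∈ I) :
    ∃ u : Rˣ, P.IsRoot u := by
  set π := Ideal.Quotient.mk I
  set c := P.coeff 1 with hc
  set n := P.natDegree
  -- Hensel's lemma needs a monic polynomial, so lift the root `-c` of the reversed polynomial.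
  set H := reflect (n + 1) P
  have H_monic : H.Monic := by
    refine monic_of_natDegree_le_of_coeff_eq_one (n + 1) ?_ ?_
    · exact natDegree_reflect_le.trans (max_le le_rfl n.le_succ)
    · simp [H, h0]
  have P_map : P.map π = 1 + C (π c) * X ^ 1 := by
    ext (_ | _ | i)
    · simp [h0]
    · simp [hc, coeff_one]
    · simpa [coeff_one, coeff_X] using Ideal.Quotient.eq_zero_iff_mem.mpr (h2 i)
  have H_map : H.map π = X ^ n * (X + C (π c)) := by
    rw [← reflect_map, P_map, reflect_add, reflect_one, reflect_C_mul_X_pow,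
      revAt_le (by omega), Nat.add_sub_cancel]
    ring
  obtain ⟨v, hv, hv_mod⟩ := HenselianRing.is_henselian (I := I) H H_monic (-c)
    (by
      rw [← Ideal.Quotient.eq_zero_iff_mem, ← eval₂_at_apply, ← eval_map, H_map]
      simp [π])
    (by
      rw [← eval₂_at_apply, ← eval_map, ← derivative_map, H_map]
      simpa [derivative_mul, π] using (h1.map π).neg.pow n)
  have v_unit : IsUnit v := by
    have := isLocalHom_of_le_jacobson_bot I HenselianRing.jac
    refine isUnit_of_map_unit π v ?_
    rw [Ideal.Quotient.eq.mpr hv_mod]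
    exact h1.neg.map _
  obtain ⟨u, rfl⟩ := v_unit
  let := u⁻¹.invertible
  exact ⟨u⁻¹, (eval₂_reflect_eq_zero_iff (RingHom.id R) (↑u⁻¹ : R) (n + 1) P n.le_succ).mp hv⟩

theorem exists_isRoot_mem_of_coeff_zero_mem {R : Type*} [CommRing R] {I : Ideal R}
    [HenselianRing R I] (G : R[X]) (h0 : G.coeff 0 ∈ I) (h1 : IsUnit (G.coeff 1)) :
    ∃ w ∈ I, G.IsRoot w := by
  set g := G.coeff 0 with hg
  set P : R[X] := 1 + X * G.divX.comp (C g * X) with hP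
  have P_coeff_succ (i : ℕ) : P.coeff (i + 1) = G.coeff (i + 1) * g ^ i := by
    simp [hP, coeff_one]
  obtain ⟨u, hu⟩ := exists_unit_isRoot_of_coeff_mem (I := I) P (by simp [hP])
    (by simpa [P_coeff_succ] using h1)
    (fun i => by
      rw [P_coeff_succ, pow_succ]
      exact I.mul_mem_left _ (I.mul_mem_left _ h0))
  refine ⟨g * u, I.mul_mem_right _ h0, ?_⟩
  have G_eval : G.eval (g * u) = g * P.eval ↑u := by
    rw [hP]
    nth_rw 1 [← X_mul_divX_add G]
    simp only [eval_add, eval_mul, eval_X, eval_C, eval_comp, eval_one, ← hg]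
    ring
  rw [IsRoot, G_eval, hu.eq_zero, mul_zero]

theorem exists_taylor_coeff_eq_zero {K : Type*} [Field K] [CharZero K] {F : K⟦X⟧[X]} {m : ℕ}
    (h0 : PowerSeries.constantCoeff (F.coeff m) = 0)
    (h1 : PowerSeries.constantCoeff (F.coeff (m + 1)) ≠ 0) :
    ∃ w, PowerSeries.constantCoeff w = 0 ∧ (taylor w F).coeff m = 0 := by
  simp_rw [taylor_coeff, ← PowerSeries.X_dvd_iff, ← Ideal.mem_span_singleton]
  refine exists_isRoot_mem_of_coeff_zero_mem (hasseDeriv m F) ?_ ?_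
  · rw [Ideal.mem_span_singleton, PowerSeries.X_dvd_iff]
    simp [hasseDeriv_coeff, h0]
  · have hm : (m : K) + 1 ≠ 0 := Nat.cast_add_one_ne_zero m
    rw [PowerSeries.isUnit_iff_constantCoeff]
    simpa [hasseDeriv_coeff, add_comm 1 m] using ⟨hm, h1⟩

theorem rootMultiplicity_lt_natDegree_of_nextCoeff_eq_zero {K : Type*} [Field K] [CharZero K]
    {h : K[X]} (h_next : h.nextCoeff = 0) {i : ℕ} (hi : i < h.natDegree) (h_coeff : h.coeff i ≠ 0)
    (c : K) : h.rootMultiplicity c < h.natDegree := by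
  by_contra! hle
  have h_eq : h = C h.leadingCoeff * (X - C c) ^ h.natDegree := by
    refine eq_leadingCoeff_mul_of_monic_of_dvd_of_natDegree_le ((monic_X_sub_C c).pow _) ?_ ?_
    · exact (pow_dvd_pow _ hle).trans (pow_rootMultiplicity_dvd h c)
    · simp
  have h_lead : h.leadingCoeff ≠ 0 := by
    rw [Ne, leadingCoeff_eq_zero]
    rintro rfl
    exact h_coeff (coeff_zero i)
  have h_next_eq : h.nextCoeff = h.leadingCoeff * (h.natDegree * -c) := by
    have h_next_pow := (monic_X_sub_C c).nextCoeff_pow h.natDegree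
    rw [nextCoeff_X_sub_C, nsmul_eq_mul, nextCoeff_of_natDegree_pos (by simp; omega)]
      at h_next_pow
    rw [nextCoeff_of_natDegree_pos (by omega), ← h_next_pow, ← coeff_C_mul, ← h_eq]
    simp
  have hc : c = 0 := by
    have h_deg : (h.natDegree : K) ≠ 0 := by exact_mod_cast (Nat.zero_lt_of_lt hi).ne'
    simpa [h_next, h_lead, h_deg] using h_next_eq
  rw [h_eq, hc, C_0, sub_zero, coeff_C_mul_X_pow, if_neg hi.ne] at h_coeff
  exact h_coeff rfl

theorem X_pow_dvd_iff_le_order {R : Type*} [Semiring R] {n : ℕ} {a : R⟦X⟧} :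
    PowerSeries.X ^ n ∣ a ↔ n ≤ a.order := by
  rw [PowerSeries.X_pow_dvd_iff]
  exact ⟨PowerSeries.nat_le_order a n,
    fun h i hi => PowerSeries.coeff_of_lt_order i ((Nat.cast_lt.mpr hi).trans_le h)⟩

theorem exists_X_pow_dvd_expand {R : Type*} [CommRing R] (a : ℕ → R⟦X⟧) {m : ℕ} (hm : 0 < m)
    (ha : ∀ i < m, PowerSeries.constantCoeff (a i) = 0) (ha0 : a 0 ≠ 0) :
    ∃ (M : ℕ) (hM : M ≠ 0) (k : ℕ), 0 < k ∧
      (∀ i < m, PowerSeries.X ^ (k * (m - i)) ∣ PowerSeries.expand M hM (a i)) ∧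
      ∃ j < m, ¬ PowerSeries.X ^ (k * (m - j) + 1) ∣ PowerSeries.expand M hM (a j) := by
  classical
  -- The vertex `j` spans the lowest edge of the Newton polygon ending in `m`; its slope is `k / M`.
  obtain ⟨j, hj, hj_min⟩ := Finset.exists_min_image {i ∈ Finset.range m | a i ≠ 0}
    (fun i => ((a i).order.toNat : ℚ) / ((m - i : ℕ) : ℚ)) ⟨0, by simp [hm, ha0]⟩
  simp only [Finset.mem_filter, Finset.mem_range] at hj hj_min
  have order_eq {i : ℕ} (hi : a i ≠ 0) : ((a i).order.toNat : ℕ∞) = (a i).order :=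
    ENat.natCast_toNat (PowerSeries.order_eq_top.not.mpr hi)
  set k := (a j).order.toNat with hk
  refine ⟨m - j, (Nat.sub_pos_of_lt hj.1).ne', k, ?_, ?_, j, hj.1, ?_⟩
  · have one_le := PowerSeries.one_le_order_iff_constCoeff_eq_zero.mpr (ha j hj.1)
    rw [← order_eq hj.2] at one_le
    exact_mod_cast one_le
  · intro i hi
    obtain hi0 | hi0 := eq_or_ne (a i) 0
    · rw [hi0, map_zero]
      exact dvd_zero _
    · have slope_le := hj_min i ⟨hi, hi0⟩
      rw [div_le_div_iff₀ (by simp [hj.1]) (by simp [hi]), mul_comm _ ((m - j : ℕ) : ℚ)]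
        at slope_le
      rw [X_pow_dvd_iff_le_order, PowerSeries.order_expand, ← order_eq hi0, nsmul_eq_mul]
      exact_mod_cast slope_le
  · rw [X_pow_dvd_iff_le_order, PowerSeries.order_expand, ← order_eq hj.2, nsmul_eq_mul]
    norm_cast
    rw [← hk, mul_comm k]
    omega

/-- The endomorphism `a(X) ↦ a(X ^ N)` of `K⟦X⟧`, which ramifies the base so that `X` gets an
`N`-th root. -/
abbrev ramify {K : Type*} [Field K] (N : ℕ) (hN : N ≠ 0) : K⟦X⟧ →+* K⟦X⟧ :=
  (PowerSeries.expand N hN : K⟦X⟧ →ₐ[K] K⟦X⟧)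

/-- `F` has, after a ramification of the base, a root in the maximal ideal of `K⟦X⟧`: it has a root
that is a Puiseux series of positive order. -/
def HasPuiseuxRoot {K : Type*} [Field K] (F : K⟦X⟧[X]) : Prop :=
  ∃ (N : ℕ) (hN : N ≠ 0) (w : K⟦X⟧),
    PowerSeries.constantCoeff w = 0 ∧ (F.map (ramify N hN)).IsRoot w

namespace HasPuiseuxRoot

variable {K : Type*} [Field K] {F : K⟦X⟧[X]}

theorem of_isRoot {w : K⟦X⟧} (hw : PowerSeries.constantCoeff w = 0) (h : F.IsRoot w) :
    HasPuiseuxRoot F := by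
  refine ⟨1, one_ne_zero, w, hw, ?_⟩
  have ramify_one : ramify (K := K) 1 one_ne_zero = RingHom.id K⟦X⟧ :=
    RingHom.ext PowerSeries.expand_one_apply
  rwa [ramify_one, Polynomial.map_id]

theorem of_taylor {w : K⟦X⟧} (hw : PowerSeries.constantCoeff w = 0)
    (h : HasPuiseuxRoot (taylor w F)) : HasPuiseuxRoot F := by
  obtain ⟨N, hN, v, hv, h_root⟩ := h
  refine ⟨N, hN, v + ramify N hN w, ?_, ?_⟩
  · simp [hw, hv, PowerSeries.constantCoeff_expand]
  · rwa [IsRoot, map_taylor, taylor_eval] at h_root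

theorem of_map_ramify {M : ℕ} {hM : M ≠ 0} (h : HasPuiseuxRoot (F.map (ramify M hM))) :
    HasPuiseuxRoot F := by
  obtain ⟨N, hN, v, hv, h_root⟩ := h
  refine ⟨N * M, mul_ne_zero hN hM, v, hv, ?_⟩
  rw [Polynomial.map_map] at h_root
  convert h_root using 2
  exact RingHom.ext fun a => PowerSeries.expand_mul N hN M hM a

theorem of_comp_eq {F₁ : K⟦X⟧[X]} {k n : ℕ} (hk : k ≠ 0) (c : K)
    (h_comp : F.comp (C (PowerSeries.X ^ k) * X) = C (PowerSeries.X ^ n) * F₁)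
    (h : HasPuiseuxRoot (taylor (PowerSeries.C c) F₁)) : HasPuiseuxRoot F := by
  obtain ⟨N, hN, v, -, h_root⟩ := h
  have ramify_C : ramify N hN (PowerSeries.C c) = PowerSeries.C c := PowerSeries.expand_C N hN c
  refine ⟨N, hN, ramify N hN (PowerSeries.X ^ k) * (v + PowerSeries.C c), ?_, ?_⟩
  · simp [hk, hN]
  · rw [IsRoot, map_taylor, taylor_eval, ramify_C] at h_root
    have h_eval := congr_arg (fun G => (G.map (ramify N hN)).eval (v + PowerSeries.C c)) h_comp
    rw [IsRoot]
    simpa only [Polynomial.map_comp, Polynomial.map_mul, map_C, map_X, eval_comp, eval_mul, eval_C,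
      eval_X, h_root, mul_zero] using h_eval

end HasPuiseuxRoot

theorem exists_comp_eq_C_X_pow_mul {R : Type*} [CommRing R] {F : R⟦X⟧[X]} {k m : ℕ}
    (hF : ∀ i < m, PowerSeries.X ^ (k * (m - i)) ∣ F.coeff i) :
    ∃ F₁, F.comp (C (PowerSeries.X ^ k) * X) = C (PowerSeries.X ^ (k * m)) * F₁ := by
  rw [← dvd_def, C_dvd_iff_dvd_coeff]
  intro i
  rw [comp_C_mul_X_coeff, ← pow_mul]
  obtain him | him := lt_or_ge i m
  · have h_dvd := mul_dvd_mul_right (hF i him) (PowerSeries.X ^ (k * i))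
    rwa [← pow_add, ← mul_add, Nat.sub_add_cancel him.le] at h_dvd
  · exact Dvd.dvd.mul_left (pow_dvd_pow _ (Nat.mul_le_mul_left k him)) _

section Blowup

variable {R : Type*} [CommRing R] {F F₁ : R⟦X⟧[X]} {k m : ℕ}

theorem X_pow_mul_coeff_of_comp_eq
    (h : F.comp (C (PowerSeries.X ^ k) * X) = C (PowerSeries.X ^ (k * m)) * F₁) (i : ℕ) :
    PowerSeries.X ^ (k * i) * F.coeff i = PowerSeries.X ^ (k * m) * F₁.coeff i := by
  rw [← coeff_C_mul (F₁), ← h, comp_C_mul_X_coeff, ← pow_mul, mul_comm]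

theorem constantCoeff_coeff_ne_zero_of_comp_eq
    (h : F.comp (C (PowerSeries.X ^ k) * X) = C (PowerSeries.X ^ (k * m)) * F₁) {i : ℕ}
    (hi : i ≤ m) (h_dvd : ¬ PowerSeries.X ^ (k * (m - i) + 1) ∣ F.coeff i) :
    PowerSeries.constantCoeff (F₁.coeff i) ≠ 0 := by
  have h_coeff := X_pow_mul_coeff_of_comp_eq h i
  rw [← Nat.add_sub_cancel' hi, mul_add, pow_add, mul_assoc, PowerSeries.X_pow_mul_inj] at h_coeff
  contrapose! h_dvd
  rw [h_coeff, pow_succ]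
  exact mul_dvd_mul_left _ (PowerSeries.X_dvd_iff.mpr h_dvd)

theorem natDegree_map_constantCoeff_of_comp_eq
    (h : F.comp (C (PowerSeries.X ^ k) * X) = C (PowerSeries.X ^ (k * m)) * F₁) (hk : k ≠ 0)
    (h_lead : PowerSeries.constantCoeff (F.coeff m) ≠ 0) :
    (F₁.map PowerSeries.constantCoeff).natDegree = m := by
  refine natDegree_eq_of_le_of_coeff_ne_zero ?_ ?_
  · refine natDegree_le_iff_coeff_eq_zero.mpr fun i hi => ?_
    obtain ⟨d, rfl⟩ := Nat.exists_eq_add_of_lt hi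
    have h_coeff := X_pow_mul_coeff_of_comp_eq h (m + d + 1)
    rw [add_assoc, mul_add, pow_add, mul_assoc, PowerSeries.X_pow_mul_inj] at h_coeff
    simp [← h_coeff, hk, add_assoc]
  · rw [coeff_map]
    refine constantCoeff_coeff_ne_zero_of_comp_eq h le_rfl ?_
    simpa [PowerSeries.X_dvd_iff] using h_lead

end Blowup

theorem exists_blowup_rootMultiplicity_lt {K : Type*} [Field K] [IsAlgClosed K] [CharZero K]
    {F : K⟦X⟧[X]} {m : ℕ} (hm : 0 < m) (h_lt : ∀ i < m, PowerSeries.constantCoeff (F.coeff i) = 0)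
    (h_lead : PowerSeries.constantCoeff (F.coeff m) ≠ 0) (h_next : F.coeff (m - 1) = 0)
    (h0 : F.coeff 0 ≠ 0) :
    ∃ (M : ℕ) (hM : M ≠ 0) (k n : ℕ) (F₁ : K⟦X⟧[X]) (c : K), k ≠ 0 ∧
      (F.map (ramify M hM)).comp (C (PowerSeries.X ^ k) * X) = C (PowerSeries.X ^ n) * F₁ ∧
      F₁.map PowerSeries.constantCoeff ≠ 0 ∧ (F₁.map PowerSeries.constantCoeff).IsRoot c ∧
      (F₁.map PowerSeries.constantCoeff).rootMultiplicity c < m := by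
  obtain ⟨M, hM, k, hk, h_dvd, j, hj, h_not_dvd⟩ := exists_X_pow_dvd_expand F.coeff hm h_lt h0
  set E := F.map (ramify M hM)
  have E_coeff (i : ℕ) : E.coeff i = PowerSeries.expand M hM (F.coeff i) := coeff_map _ i
  simp_rw [← E_coeff] at h_dvd h_not_dvd
  obtain ⟨F₁, hF₁⟩ := exists_comp_eq_C_X_pow_mul h_dvd
  set h := F₁.map PowerSeries.constantCoeff
  have h_deg : h.natDegree = m := natDegree_map_constantCoeff_of_comp_eq hF₁ hk.ne' (by
    rwa [E_coeff, PowerSeries.constantCoeff_expand])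
  have h_nextCoeff : h.nextCoeff = 0 := by
    have h_coeff := X_pow_mul_coeff_of_comp_eq hF₁ (m - 1)
    rw [E_coeff, h_next, map_zero, mul_zero, zero_eq_mul,
      or_iff_right (pow_ne_zero _ PowerSeries.X_ne_zero)] at h_coeff
    rw [nextCoeff_of_natDegree_pos (by omega), h_deg, coeff_map, h_coeff, map_zero]
  have h_coeff_j : h.coeff j ≠ 0 := by
    rw [coeff_map]
    exact constantCoeff_coeff_ne_zero_of_comp_eq hF₁ hj.le h_not_dvd
  obtain ⟨c, hc⟩ := IsAlgClosed.exists_root h (natDegree_pos_iff_degree_pos.mp (h_deg ▸ hm)).ne'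
  have h_mult := rootMultiplicity_lt_natDegree_of_nextCoeff_eq_zero h_nextCoeff (h_deg ▸ hj)
    h_coeff_j c
  refine ⟨M, hM, k, k * m, F₁, c, hk.ne', hF₁, ?_, hc, h_deg ▸ h_mult⟩
  exact fun h_zero : h = 0 => h_coeff_j (by rw [h_zero, coeff_zero])

theorem hasPuiseuxRoot_of_constantCoeff_coeff_zero {K : Type*} [Field K] [IsAlgClosed K]
    [CharZero K] {F : K⟦X⟧[X]} (hF : F.map PowerSeries.constantCoeff ≠ 0)
    (h0 : PowerSeries.constantCoeff (F.coeff 0) = 0) : HasPuiseuxRoot F := by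
  induction hm : (F.map PowerSeries.constantCoeff).natTrailingDegree using
    Nat.strong_induction_on generalizing F with
  | _ m ih =>
  have h_lt (i : ℕ) (hi : i < m) : PowerSeries.constantCoeff (F.coeff i) = 0 := by
    rw [← coeff_map]
    exact coeff_eq_zero_of_lt_natTrailingDegree (hm ▸ hi)
  have h_lead : PowerSeries.constantCoeff (F.coeff m) ≠ 0 := by
    rw [← coeff_map, ← hm]
    exact trailingCoeff_nonzero_iff_nonzero.mpr hF
  have hm_pos : 0 < m := Nat.pos_of_ne_zero fun h => h_lead (h ▸ h0)
  obtain ⟨w, hw, h_next⟩ := exists_taylor_coeff_eq_zero (h_lt (m - 1) (by omega))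
    (by rwa [Nat.sub_add_cancel hm_pos])
  have taylor_coeff_eq (i : ℕ) : PowerSeries.constantCoeff ((taylor w F).coeff i) =
      PowerSeries.constantCoeff (F.coeff i) := by
    rw [← coeff_map, map_taylor, hw, taylor_zero, coeff_map]
  simp_rw [← taylor_coeff_eq] at h_lt h_lead
  refine .of_taylor hw ?_
  obtain hT | hT := eq_or_ne ((taylor w F).coeff 0) 0
  · exact .of_isRoot (map_zero _) (by rwa [IsRoot, ← coeff_zero_eq_eval_zero])
  obtain ⟨M, hM, k, n, F₁, c, hk, h_comp, h_ne, h_root, h_mult⟩ :=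
    exists_blowup_rootMultiplicity_lt hm_pos h_lt h_lead h_next hT
  refine .of_map_ramify (hM := hM) (.of_comp_eq hk c h_comp ?_)
  have h_map : (taylor (PowerSeries.C c) F₁).map PowerSeries.constantCoeff =
      taylor c (F₁.map PowerSeries.constantCoeff) := by
    rw [map_taylor, PowerSeries.constantCoeff_C]
  refine ih _ h_mult ?_ ?_ ?_
  · rwa [h_map, Ne, taylor_eq_zero]
  · rw [← coeff_map, h_map, taylor_coeff_zero, h_root.eq_zero]
  · rw [h_map, taylor_apply, rootMultiplicity_eq_natTrailingDegree]

end NewtonPuiseux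

section Evaluation

variable {K R F L : Type*} [Field K] [CommRing R] [Algebra K R] [Field F] [Algebra R F]
  [Algebra K F] [IsScalarTower K R F] [Field L] [Algebra K L]

variable (F) in
/-- The graph of the partial evaluation map from the fraction field `F` of `R` to `L` that sends
`N / D` to `φ N / φ D` whenever `φ D ≠ 0`. Being a subalgebra of `F × L`, it is stable under
polynomial expressions. -/
def evalGraph (φ : R →ₐ[K] L) : Subalgebra K (F × L) where
  carrier := {z | ∃ N D : R, φ D ≠ 0 ∧
    z.1 * algebraMap R F D = algebraMap R F N ∧ z.2 * φ D = φ N}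
  mul_mem' := by
    rintro z w ⟨N, D, hD, h₁, h₂⟩ ⟨N', D', hD', h₁', h₂'⟩
    refine ⟨N * N', D * D', by simp [hD, hD'], ?_, ?_⟩
    · simp only [map_mul, ← h₁, ← h₁', Prod.fst_mul]; ring
    · simp only [map_mul, ← h₂, ← h₂', Prod.snd_mul]; ring
  add_mem' := by
    rintro z w ⟨N, D, hD, h₁, h₂⟩ ⟨N', D', hD', h₁', h₂'⟩
    refine ⟨N * D' + N' * D, D * D', by simp [hD, hD'], ?_, ?_⟩
    · simp only [map_add, map_mul, ← h₁, ← h₁', Prod.fst_add]; ring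
    · simp only [map_add, map_mul, ← h₂, ← h₂', Prod.snd_add]; ring
  algebraMap_mem' c := ⟨algebraMap K R c, 1, by simp, by
    simp [← IsScalarTower.algebraMap_apply], by simp⟩

theorem algebraMap_mem_evalGraph (φ : R →ₐ[K] L) (P : R) :
    (algebraMap R F P, φ P) ∈ evalGraph F φ :=
  ⟨P, 1, by simp, by simp, by simp⟩

variable {φ : R →ₐ[K] L}

theorem div_mem_evalGraph [FaithfulSMul R F] {r s : F} {v w : L} (hr : (r, v) ∈ evalGraph F φ)
    (hs : (s, w) ∈ evalGraph F φ) (hw : w ≠ 0) : (r / s, v / w) ∈ evalGraph F φ := by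
  obtain ⟨N, D, hD, h₁, h₂⟩ := hs
  have hN : φ N ≠ 0 := by rw [← h₂]; exact mul_ne_zero hw hD
  have hs₀ : s ≠ 0 := by
    rintro rfl
    have hN₀ : N = 0 := (FaithfulSMul.algebraMap_eq_zero_iff R F).mp (by rw [← h₁]; simp)
    exact hN (by rw [hN₀, map_zero])
  have hinv : (s⁻¹, w⁻¹) ∈ evalGraph F φ :=
    ⟨D, N, hN, by simp [← h₁, hs₀], by simp [← h₂, hw]⟩
  simpa only [div_eq_mul_inv, Prod.mk_mul_mk] using mul_mem hr hinv

theorem evalGraph_unique [FaithfulSMul R F] {r : F} {v w : L} (h : (r, v) ∈ evalGraph F φ)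
    (h' : (r, w) ∈ evalGraph F φ) : v = w := by
  obtain ⟨N, D, hD, h₁, h₂⟩ := h
  obtain ⟨N', D', hD', h₁', h₂'⟩ := h'
  have hcross : N * D' = N' * D := by
    apply FaithfulSMul.algebraMap_injective R F
    rw [map_mul, map_mul, ← h₁, ← h₁']
    ring
  have hφ := congrArg φ hcross
  rw [map_mul, map_mul, ← h₂, ← h₂'] at hφ
  refine mul_right_cancel₀ (mul_ne_zero hD hD') ?_
  linear_combination hφ

theorem mvAeval_mem_evalGraph {σ : Type*} {r : σ → F} {v : σ → L}
    (h : ∀ i, (r i, v i) ∈ evalGraph F φ) (P : MvPolynomial σ K) :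
    (MvPolynomial.aeval r P, MvPolynomial.aeval v P) ∈ evalGraph F φ := by
  let z : σ → evalGraph F φ := fun i => ⟨(r i, v i), h i⟩
  have hz : (MvPolynomial.aeval r P, MvPolynomial.aeval v P) = (MvPolynomial.aeval z P).1 :=
    Prod.ext
      (MvPolynomial.comp_aeval_apply z ((AlgHom.fst K F L).comp (evalGraph F φ).val) P).symm
      (MvPolynomial.comp_aeval_apply z ((AlgHom.snd K F L).comp (evalGraph F φ).val) P).symm
  exact hz ▸ (MvPolynomial.aeval z P).2

theorem aeval_mem_evalGraph {r : F} {v : L} (h : (r, v) ∈ evalGraph F φ) (P : Polynomial K) :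
    (Polynomial.aeval r P, Polynomial.aeval v P) ∈ evalGraph F φ := by
  let z : evalGraph F φ := ⟨(r, v), h⟩
  have hz : (Polynomial.aeval r P, Polynomial.aeval v P) = (Polynomial.aeval z P).1 := Prod.ext
    (Polynomial.aeval_algHom_apply ((AlgHom.fst K F L).comp (evalGraph F φ).val) z P)
    (Polynomial.aeval_algHom_apply ((AlgHom.snd K F L).comp (evalGraph F φ).val) z P)
  exact hz ▸ (Polynomial.aeval z P).2

theorem moebius_mem_evalGraph [FaithfulSMul R F] {r : F} {v : L} (h : (r, v) ∈ evalGraph F φ)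
    (A : GL (Fin 2) K) (hA : algebraMap K L (A 1 0) * v + algebraMap K L (A 1 1) ≠ 0) :
    (moebius A r, moebius A v) ∈ evalGraph F φ := by
  have hlin (c d : K) : (algebraMap K F c * r + algebraMap K F d,
      algebraMap K L c * v + algebraMap K L d) ∈ evalGraph F φ :=
    add_mem (mul_mem (algebraMap_mem _ c) h) (algebraMap_mem _ d)
  exact div_mem_evalGraph (hlin _ _) (hlin _ _) hA

theorem ratFuncEval_mem_evalGraph {K F L : Type u} [Field K] [Algebra K R] [Field F]
    [Algebra R F] [Algebra K F] [IsScalarTower K R F] [FaithfulSMul R F] [Field L] [Algebra K L]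
    {φ : R →ₐ[K] L} {r : F} {v : L} (h : (r, v) ∈ evalGraph F φ) (f : RatFunc K)
    (hf : Polynomial.aeval v f.denom ≠ 0) :
    (f.eval (algebraMap K F) r, f.eval (algebraMap K L) v) ∈ evalGraph F φ :=
  div_mem_evalGraph (aeval_mem_evalGraph h f.num) (aeval_mem_evalGraph h f.denom) hf

theorem den_ne_zero_of_mem_evalGraph [IsDomain R] [UniqueFactorizationMonoid R]
    [IsFractionRing R F] {r : F} {v : L} (h : (r, v) ∈ evalGraph F φ) :
    φ (IsFractionRing.den R r) ≠ 0 := by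
  obtain ⟨N, D, hD, h₁, -⟩ := h
  suffices hdvd : (IsFractionRing.den R r : R) ∣ D by
    obtain ⟨c, rfl⟩ := hdvd
    rw [map_mul] at hD
    exact left_ne_zero_of_mul hD
  refine (IsFractionRing.num_den_reduced R r).symm.dvd_of_dvd_mul_left (Dvd.intro N ?_)
  apply IsFractionRing.injective R F
  rw [map_mul, map_mul, ← h₁, ← mul_assoc, mul_comm (algebraMap R F _) r,
    IsFractionRing.num_mul_den_eq_num_iff_eq.mpr rfl]

end Evaluation

section EvalRat

variable {K L : Type*} [Field K] [Field L] [Algebra K L] {a b : L}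

theorem aeval_pair_mem_evalGraph {R F : Type*} [CommRing R] [Algebra K R] [Field F] [Algebra R F]
    [Algebra K F] [IsScalarTower K R F] {φ : R →ₐ[K] L} {r s : F} (hr : (r, a) ∈ evalGraph F φ)
    (hs : (s, b) ∈ evalGraph F φ) (P : Poly2 K) :
    (MvPolynomial.aeval ![r, s] P, MvPolynomial.aeval ![a, b] P) ∈ evalGraph F φ :=
  mvAeval_mem_evalGraph (by simp [Fin.forall_fin_two, hr, hs]) P

theorem evalRat_mem_evalGraph {R F : Type*} [CommRing R] [Algebra K R] [Field F] [Algebra R F]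
    [Algebra K F] [IsScalarTower K R F] [FaithfulSMul R F] {φ : R →ₐ[K] L} {r s : F}
    (hr : (r, a) ∈ evalGraph F φ) (hs : (s, b) ∈ evalGraph F φ) {q : Rat2 K}
    (hq : MvPolynomial.aeval ![a, b] (den q) ≠ 0) :
    (evalRat r s q, evalRat a b q) ∈ evalGraph F φ :=
  div_mem_evalGraph (aeval_pair_mem_evalGraph hr hs _) (aeval_pair_mem_evalGraph hr hs _) hq

theorem xx_mem_evalGraph (a b : L) :
    (xx K, a) ∈ evalGraph (Rat2 K) (MvPolynomial.aeval (R := K) ![a, b]) := by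
  simpa [xx] using algebraMap_mem_evalGraph (F := Rat2 K)
    (MvPolynomial.aeval (R := K) ![a, b]) (MvPolynomial.X 0)

theorem yy_mem_evalGraph (a b : L) :
    (yy K, b) ∈ evalGraph (Rat2 K) (MvPolynomial.aeval (R := K) ![a, b]) := by
  simpa [yy] using algebraMap_mem_evalGraph (F := Rat2 K)
    (MvPolynomial.aeval (R := K) ![a, b]) (MvPolynomial.X 1)

theorem self_mem_evalGraph {r : Rat2 K} (h : MvPolynomial.aeval ![a, b] (den r) ≠ 0) :
    (r, evalRat a b r) ∈ evalGraph (Rat2 K) (MvPolynomial.aeval (R := K) ![a, b]) := by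
  have hr := div_mem_evalGraph (algebraMap_mem_evalGraph (F := Rat2 K) _ (num r))
    (algebraMap_mem_evalGraph _ (den r)) h
  rwa [num, den, ← IsFractionRing.mk'_eq_div, IsFractionRing.mk'_num_den] at hr

theorem evalRat_eq_of_mem_evalGraph {r : Rat2 K} {v : L}
    (h : (r, v) ∈ evalGraph (Rat2 K) (MvPolynomial.aeval (R := K) ![a, b])) :
    evalRat a b r = v :=
  evalGraph_unique (self_mem_evalGraph (den_ne_zero_of_mem_evalGraph h)) h

end EvalRat

section GenericPoint

variable {K L : Type*} [Field K] [Field L] [Algebra K L]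

theorem aeval_eq_eval₂_finSuccEquiv (a b : L) (P : Poly2 K) :
    MvPolynomial.aeval ![a, b] P = (MvPolynomial.finSuccEquiv K 1 P).eval₂
      (MvPolynomial.aeval (R := K) fun _ : Fin 1 => b).toRingHom a := by
  induction P using MvPolynomial.induction_on with
  | C c => simp [MvPolynomial.finSuccEquiv_apply]
  | add p q hp hq => rw [map_add, map_add, hp, hq, Polynomial.eval₂_add]
  | mul_X p i hp =>
    rw [map_mul, map_mul, hp, Polynomial.eval₂_mul]
    congr 1
    fin_cases i
    · simp [MvPolynomial.finSuccEquiv_apply]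
    · have hX := MvPolynomial.finSuccEquiv_X_succ (R := K) (j := (0 : Fin 1))
      rw [Fin.succ_zero_eq_one] at hX
      simp [hX]

theorem eval₂_ne_zero_of_not_dvd {R : Type*} [CommRing R] [IsDomain R] [IsGCDMonoid R]
    {φ : R →+* L} (hφ : Function.Injective φ) {p d : Polynomial R} (hp : Irreducible p)
    (hdeg : p.natDegree ≠ 0) {a : L} (hpa : p.eval₂ φ a = 0) (hd : ¬ p ∣ d) :
    d.eval₂ φ a ≠ 0 := by
  intro hda
  have hprim : p.IsPrimitive := hp.isPrimitive hdeg
  have hirr := (hprim.irreducible_iff_irreducible_map_fraction_map (K := FractionRing R)).mp hp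
  obtain ⟨u, v, huv⟩ := hirr.coprime_iff_not_dvd.mpr fun h =>
    hd (hprim.dvd_of_fraction_map_dvd_fraction_map (q := d) h)
  have hlift : (IsFractionRing.lift hφ : FractionRing R →+* L).comp
      (algebraMap R (FractionRing R)) = φ :=
    RingHom.ext fun x => IsFractionRing.lift_algebraMap hφ x
  have heval := congrArg (Polynomial.eval₂ (IsFractionRing.lift hφ) a) huv
  simp [Polynomial.eval₂_add, Polynomial.eval₂_mul, Polynomial.eval₂_map, hlift, hpa, hda] at heval

theorem aeval_ne_zero_of_not_dvd {p d : Poly2 K} (hp : Irreducible p) (hpx : 0 < p.degreeOf 0)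
    {a b : L} (hb : Transcendental K b) (hpab : MvPolynomial.aeval ![a, b] p = 0)
    (hd : ¬ p ∣ d) : MvPolynomial.aeval ![a, b] d ≠ 0 := by
  rw [aeval_eq_eval₂_finSuccEquiv] at hpab ⊢
  refine eval₂_ne_zero_of_not_dvd ?_ ((MulEquiv.irreducible_iff _).mpr hp) ?_ hpab
    fun h => hd ((map_dvd_iff (MvPolynomial.finSuccEquiv K 1)).mp h)
  · exact (algebraicIndependent_unique_type_iff (x := fun _ : Fin 1 => b)).mpr hb
  · rw [MvPolynomial.natDegree_finSuccEquiv]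
    exact hpx.ne'

theorem evalRat_eq_sub_of_mem_sepSet {K L : Type u} [Field K] [Field L] [Algebra K L] {p : Poly2 K}
    (hp : Irreducible p) (hpx : 0 < p.degreeOf 0) {r : Rat2 K} (hr : InLocalRing p r)
    {f g : RatFunc K} (hfg : (f, g) ∈ sepSet r p) {a b : L} (ha : Transcendental K a)
    (hb : Transcendental K b) (hab : MvPolynomial.aeval ![a, b] p = 0) :
    evalRat a b r = f.eval (algebraMap K L) a - g.eval (algebraMap K L) b := by
  obtain ⟨q, hq, hqr⟩ := hfg
  have hreg {s : Rat2 K} (hs : InLocalRing p s) : MvPolynomial.aeval ![a, b] (den s) ≠ 0 :=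
    aeval_ne_zero_of_not_dvd hp hpx hb hab hs
  have hleft := add_mem (self_mem_evalGraph (hreg hr))
    (mul_mem (self_mem_evalGraph (hreg hq)) (algebraMap_mem_evalGraph _ p))
  have hright := sub_mem
    (ratFuncEval_mem_evalGraph (xx_mem_evalGraph a b) f
      (mt (transcendental_iff.mp ha _) f.denom_ne_zero))
    (ratFuncEval_mem_evalGraph (yy_mem_evalGraph a b) g
      (mt (transcendental_iff.mp hb _) g.denom_ne_zero))
  rw [Prod.mk_mul_mk, Prod.mk_add_mk, hqr, hab, mul_zero, add_zero] at hleft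
  exact evalGraph_unique hleft hright

end GenericPoint

section Valuation

open Polynomial

variable {K L Γ₀ : Type*} [Field K] [Field L] [Algebra K L] [LinearOrderedCommGroupWithZero Γ₀]
  (v : Valuation L Γ₀) [v.IsTrivialOn K]

theorem valuation_aeval_le_one {a : L} (ha : v a ≤ 1) (P : K[X]) : v (aeval a P) ≤ 1 := by
  rw [aeval_eq_sum_range]
  refine v.map_sum_le fun i _ => ?_
  rw [Algebra.smul_def, map_mul, map_pow]
  exact mul_le_one' (Valuation.IsTrivialOn.valuation_algebraMap_le_one v _) (pow_le_one' ha i)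

theorem valuation_aeval_eq_pow_rootMultiplicity {a : L} {s : K}
    (ha : v (a - algebraMap K L s) < 1) {P : K[X]} (hP : P ≠ 0) :
    v (aeval a P) = v (a - algebraMap K L s) ^ P.rootMultiplicity s := by
  obtain ⟨Q, hPQ, hQ⟩ := P.exists_eq_pow_rootMultiplicity_mul_and_not_dvd hP s
  rw [dvd_iff_isRoot, IsRoot] at hQ
  have ha₁ : v a ≤ 1 := by
    rw [← sub_add_cancel a (algebraMap K L s)]
    exact v.map_add_le ha.le (Valuation.IsTrivialOn.valuation_algebraMap_le_one v s)
  have hQa : v (aeval a Q) = 1 := by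
    rw [← modByMonic_add_div Q (X - C s), modByMonic_X_sub_C_eq_C_eval, map_add, map_mul, aeval_C,
      ← Valuation.IsTrivialOn.eq_one (v := v) _ hQ]
    apply v.map_add_eq_of_lt_left
    rw [Valuation.IsTrivialOn.eq_one _ hQ, map_mul, map_sub, aeval_X, aeval_C]
    exact mul_lt_one_of_lt_of_le ha (valuation_aeval_le_one v ha₁ _)
  conv_lhs => rw [hPQ]
  rw [map_mul, map_pow, map_sub, aeval_X, aeval_C, map_mul, map_pow, hQa, mul_one]

/-- Minus the order of vanishing at `s ∈ ℙ¹` of a polynomial: the analogue of `mult` for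
polynomials. -/
def polyMult (s : OnePoint K) (P : K[X]) : ℤ :=
  s.elim (P.natDegree : ℤ) fun a => -(P.rootMultiplicity a : ℤ)

theorem mult_eq_polyMult_sub (s : OnePoint K) (f : RatFunc K) :
    mult s f = polyMult s f.num - polyMult s f.denom := by
  cases s with
  | infty => rfl
  | coe a => simp only [mult, polyMult, OnePoint.elim_some]; ring

theorem mult_zero (s : OnePoint K) : mult s (0 : RatFunc K) = 0 := by
  rw [mult_eq_polyMult_sub]
  cases s <;> simp [polyMult]

variable {v} {z : L}

theorem valuation_linear (hz : 1 < v z) {c : K} (hc : c ≠ 0) (d : K) :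
    v (algebraMap K L c * z + algebraMap K L d) = v z := by
  have hcz : v (algebraMap K L c * z) = v z := by
    rw [map_mul, Valuation.IsTrivialOn.eq_one c hc, one_mul]
  rw [← hcz]
  apply v.map_add_eq_of_lt_left
  rw [hcz]
  exact (Valuation.IsTrivialOn.valuation_algebraMap_le_one v d).trans_lt hz

theorem moebius_denom_ne_zero (hz : 1 < v z) (A : GL (Fin 2) K) :
    algebraMap K L (A 1 0) * z + algebraMap K L (A 1 1) ≠ 0 := by
  by_cases h : A 1 0 = 0
  · have hdet := A.det_ne_zero
    rw [Matrix.det_fin_two, h, mul_zero, sub_zero] at hdet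
    simpa [h] using right_ne_zero_of_mul hdet
  · rw [← v.ne_zero_iff, valuation_linear hz h]
    exact (zero_lt_one.trans hz).ne'

theorem valuation_moebius_of_eq_zero (hz : 1 < v z) {A : GL (Fin 2) K} (h : A 1 0 = 0) :
    v (moebius A z) = v z := by
  have hdet := A.det_ne_zero
  rw [Matrix.det_fin_two, h, mul_zero, sub_zero] at hdet
  rw [moebius, map_div₀, valuation_linear hz (left_ne_zero_of_mul hdet), h, map_zero, zero_mul,
    zero_add, Valuation.IsTrivialOn.eq_one _ (right_ne_zero_of_mul hdet), div_one]

theorem valuation_moebius_sub (hz : 1 < v z) {A : GL (Fin 2) K} (h : A 1 0 ≠ 0) :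
    v (moebius A z - algebraMap K L (A 0 0 / A 1 0)) = (v z)⁻¹ := by
  have hden := moebius_denom_ne_zero hz A
  have hc : algebraMap K L (A 1 0) ≠ 0 := by simpa using h
  have hdet := A.det_ne_zero
  rw [Matrix.det_fin_two] at hdet
  have hsub : moebius A z - algebraMap K L (A 0 0 / A 1 0) =
      -algebraMap K L (A 0 0 * A 1 1 - A 0 1 * A 1 0) /
        (algebraMap K L (A 1 0) * (algebraMap K L (A 1 0) * z + algebraMap K L (A 1 1))) := by
    rw [moebius, map_div₀, div_sub_div _ _ hden hc, mul_comm (_ + _) (algebraMap K L (A 1 0))]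
    simp only [map_sub, map_mul]
    ring
  rw [hsub, map_div₀, Valuation.map_neg, map_mul, valuation_linear hz h,
    Valuation.IsTrivialOn.eq_one _ hdet, Valuation.IsTrivialOn.eq_one _ h, one_mul, one_div]

theorem valuation_aeval_moebius [DecidableEq K] (hz : 1 < v z) (A : GL (Fin 2) K) {P : K[X]}
    (hP : P ≠ 0) : v (aeval (moebius A z) P) = v z ^ polyMult (A • ∞) P := by
  rw [smul_infty_eq_ite]
  split_ifs with h
  · have hAz := valuation_moebius_of_eq_zero hz h
    rw [valuation_aeval_eq_valuation_X_pow_natDegree_of_one_lt_valuation_X _ (hAz ▸ hz) hP, hAz]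
    exact (zpow_natCast _ _).symm
  · have hAz := valuation_moebius_sub hz h
    rw [valuation_aeval_eq_pow_rootMultiplicity v (hAz ▸ inv_lt_one_of_one_lt₀ hz) hP, hAz]
    simp [polyMult]

theorem aeval_moebius_ne_zero (hz : 1 < v z) (A : GL (Fin 2) K) {P : K[X]} (hP : P ≠ 0) :
    aeval (moebius A z) P ≠ 0 := by
  classical
  rw [← v.ne_zero_iff, valuation_aeval_moebius hz A hP]
  exact zpow_ne_zero _ (zero_lt_one.trans hz).ne'

theorem transcendental_moebius (hz : 1 < v z) (A : GL (Fin 2) K) :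
    Transcendental K (moebius A z) :=
  transcendental_iff.mpr fun _ hP => by_contra fun hP₀ => aeval_moebius_ne_zero hz A hP₀ hP

end Valuation

section RatFuncValuation

variable {K L : Type u} {Γ₀ : Type*} [Field K] [DecidableEq K] [Field L] [Algebra K L]
  [LinearOrderedCommGroupWithZero Γ₀] {v : Valuation L Γ₀} [v.IsTrivialOn K] {z : L}

theorem valuation_eval_moebius (hz : 1 < v z) (A : GL (Fin 2) K) {f : RatFunc K} (hf : f ≠ 0) :
    v (f.eval (algebraMap K L) (moebius A z)) = v z ^ mult (A • ∞) f := by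
  rw [RatFunc.eval, map_div₀, mult_eq_polyMult_sub, zpow_sub₀ (zero_lt_one.trans hz).ne',
    ← valuation_aeval_moebius hz A (RatFunc.num_ne_zero hf),
    ← valuation_aeval_moebius hz A f.denom_ne_zero]
  rfl

end RatFuncValuation

section Degree

open WithZero

variable {K : Type*} [Field K]

variable (K) in
/-- The valuation `exp ∘ degSer` on Hahn series, for which large means of large degree in
`x = t⁻¹`: the multiplicative form of `HahnSeries.addVal`, with values in a group with zero. -/
def degVal : Valuation (HahnSeries ℚ K) (WithZero (Multiplicative ℚ)) where
  toFun φ := open Classical in if φ = 0 then 0 else exp (degSer φ)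
  map_zero' := if_pos rfl
  map_one' := by simp [degSer]
  map_mul' φ ψ := by
    by_cases hφ : φ = 0
    · simp [hφ]
    by_cases hψ : ψ = 0
    · simp [hψ]
    rw [if_neg (mul_ne_zero hφ hψ), if_neg hφ, if_neg hψ, ← exp_add, degSer,
      HahnSeries.order_mul hφ hψ, neg_add, degSer, degSer]
  map_add_le_max' φ ψ := by
    by_cases hφ : φ = 0
    · rw [hφ, zero_add]
      exact le_max_right _ _
    by_cases hψ : ψ = 0
    · rw [hψ, add_zero]
      exact le_max_left _ _
    by_cases hφψ : φ + ψ = 0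
    · simp [hφψ]
    rw [if_neg hφψ, if_neg hφ, if_neg hψ, le_max_iff, exp_le_exp, exp_le_exp, degSer, degSer,
      degSer, neg_le_neg_iff, neg_le_neg_iff, ← min_le_iff]
    exact HahnSeries.min_order_le_order_add hφψ

theorem degVal_of_ne_zero {φ : HahnSeries ℚ K} (hφ : φ ≠ 0) : degVal K φ = exp (degSer φ) :=
  if_neg hφ

theorem log_degVal (φ : HahnSeries ℚ K) : log (degVal K φ) = degSer φ := by
  by_cases hφ : φ = 0
  · simp [hφ, degSer]
  · rw [degVal_of_ne_zero hφ, log_exp]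

theorem one_lt_degVal_iff {φ : HahnSeries ℚ K} : 1 < degVal K φ ↔ 0 < degSer φ := by
  by_cases hφ : φ = 0
  · simp [hφ, degSer]
  · rw [degVal_of_ne_zero hφ, ← exp_zero, exp_lt_exp]

theorem algebraMap_hahnSeries (c : K) : algebraMap K (HahnSeries ℚ K) c = HahnSeries.C c := by
  rw [HahnSeries.algebraMap_apply']
  exact HahnSeries.ofPowerSeries_C c

instance isTrivialOn_degVal : (degVal K).IsTrivialOn K where
  eq_one c hc := by
    rw [algebraMap_hahnSeries, degVal_of_ne_zero (HahnSeries.C_ne_zero hc), degSer,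
      HahnSeries.order_C, neg_zero, exp_zero]

theorem degSer_sub_swap (φ ψ : HahnSeries ℚ K) : degSer (φ - ψ) = degSer (ψ - φ) := by
  rw [← log_degVal, Valuation.map_sub_swap, log_degVal]

theorem degSer_inv (φ : HahnSeries ℚ K) : degSer φ⁻¹ = -degSer φ := by
  rw [← log_degVal, map_inv₀, log_inv, log_degVal]

theorem degSer_sub_of_lt {φ ψ : HahnSeries ℚ K} (hφ : 0 < degSer φ) (h : degSer ψ < degSer φ) :
    degSer (φ - ψ) = degSer φ := by
  have hlt : degVal K ψ < degVal K φ := by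
    rcases eq_or_ne ψ 0 with rfl | hψ
    · rw [map_zero]
      exact zero_lt_one.trans (one_lt_degVal_iff.mpr hφ)
    · have hφ₀ : φ ≠ 0 := by rintro rfl; simp [degSer] at hφ
      rwa [degVal_of_ne_zero hψ, degVal_of_ne_zero hφ₀, exp_lt_exp]
  rw [← log_degVal, Valuation.map_sub_eq_of_lt_left _ hlt, log_degVal]

theorem degSer_pos_or_pos_of_sub_pos {φ ψ : HahnSeries ℚ K} (h : 0 < degSer (φ - ψ)) :
    0 < degSer φ ∨ 0 < degSer ψ := by
  simp only [← one_lt_degVal_iff] at h ⊢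
  exact lt_max_iff.mp (h.trans_le ((degVal K).map_sub φ ψ))

theorem degSer_eq_of_sub_not_pos {φ ψ : HahnSeries ℚ K} (h : ¬ 0 < degSer (φ - ψ))
    (hpos : 0 < degSer φ ∨ 0 < degSer ψ) : degSer φ = degSer ψ := by
  wlog hle : degSer ψ ≤ degSer φ generalizing φ ψ
  · exact (this (by rwa [degSer_sub_swap]) hpos.symm (le_of_not_ge hle)).symm
  have hφ : 0 < degSer φ := hpos.elim id fun hψ => hψ.trans_le hle
  by_contra hne
  exact h (by rwa [degSer_sub_of_lt hφ (lt_of_le_of_ne' hle hne)])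

theorem degSer_eval_moebius [DecidableEq K] {φ : HahnSeries ℚ K} (hφ : 0 < degSer φ)
    (A : GL (Fin 2) K) (f : RatFunc K) :
    degSer (f.eval (algebraMap K _) (moebius A φ)) = mult (A • ∞) f * degSer φ := by
  by_cases hf : f = 0
  · simp [hf, mult_zero, RatFunc.eval_zero, degSer]
  · rw [← log_degVal, valuation_eval_moebius (one_lt_degVal_iff.mpr hφ) A hf, log_zpow,
      log_degVal, zsmul_eq_mul]

theorem degSer_xSer : degSer (xSer K) = 1 := by
  rw [degSer, xSer, HahnSeries.order_single one_ne_zero, neg_neg]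

end Degree

section BiHom

/-- The bi-homogenization of `p`, evaluated in a `K`-algebra; over `K` itself this is `biHom`. -/
def biHomEval {K R : Type*} [Field K] [CommRing R] [Algebra K R] (p : Poly2 K) (x y : R × R) : R :=
  ∑ m ∈ p.support, algebraMap K R (p.coeff m) *
    (x.1 ^ (p.degreeOf 0 - m 0) * x.2 ^ m 0) * (y.1 ^ (p.degreeOf 1 - m 1) * y.2 ^ m 1)

variable {K R : Type*} [Field K] [CommRing R] [Algebra K R]

theorem map_biHomEval {S : Type*} [CommRing S] [Algebra K S] {φ : R →+* S}
    (hφ : ∀ c, φ (algebraMap K R c) = algebraMap K S c) (p : Poly2 K) (x y : R × R) :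
    φ (biHomEval p x y) = biHomEval p (x.map φ φ) (y.map φ φ) := by
  simp only [biHomEval, map_sum, map_mul, map_pow, hφ, Prod.map_fst, Prod.map_snd]

theorem biHomEval_smul_smul (p : Poly2 K) (c d : R) (x y : R × R) :
    biHomEval p (c • x) (d • y) = c ^ p.degreeOf 0 * d ^ p.degreeOf 1 * biHomEval p x y := by
  rw [biHomEval, biHomEval, Finset.mul_sum]
  refine Finset.sum_congr rfl fun m hm => ?_
  simp only [Prod.smul_fst, Prod.smul_snd, smul_eq_mul, mul_pow]
  rw [← pow_sub_mul_pow c (MvPolynomial.monomial_le_degreeOf 0 hm),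
    ← pow_sub_mul_pow d (MvPolynomial.monomial_le_degreeOf 1 hm)]
  ring

theorem biHomEval_one_one (p : Poly2 K) (a b : R) :
    biHomEval p (1, a) (1, b) = MvPolynomial.aeval ![a, b] p := by
  rw [biHomEval, MvPolynomial.aeval_def, MvPolynomial.eval₂_eq']
  simp [mul_assoc]

/-- The polynomial `p(y, x)`. -/
def swapVars (p : Poly2 K) : Poly2 K := MvPolynomial.rename (Equiv.swap 0 1) p

theorem degreeOf_zero_swapVars (p : Poly2 K) : (swapVars p).degreeOf 0 = p.degreeOf 1 :=
  MvPolynomial.degreeOf_rename_of_injective (Equiv.swap (0 : Fin 2) 1).injective 1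

theorem degreeOf_one_swapVars (p : Poly2 K) : (swapVars p).degreeOf 1 = p.degreeOf 0 :=
  MvPolynomial.degreeOf_rename_of_injective (Equiv.swap (0 : Fin 2) 1).injective 0

theorem irreducible_swapVars {p : Poly2 K} (hp : Irreducible p) : Irreducible (swapVars p) :=
  (MulEquiv.irreducible_iff (MvPolynomial.renameEquiv K (Equiv.swap (0 : Fin 2) 1))).mpr hp

theorem biHomEval_swapVars (p : Poly2 K) (x y : R × R) :
    biHomEval (swapVars p) y x = biHomEval p x y := by
  have hinj := (Equiv.swap (0 : Fin 2) 1).injective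
  rw [biHomEval, biHomEval, degreeOf_zero_swapVars, degreeOf_one_swapVars, swapVars,
    MvPolynomial.support_rename_of_injective hinj,
    Finset.sum_image (fun m _ m' _ h => Finsupp.mapDomain_injective hinj h)]
  refine Finset.sum_congr rfl fun m _ => ?_
  have h₀ : Finsupp.mapDomain (Equiv.swap (0 : Fin 2) 1) m 0 = m 1 :=
    Finsupp.mapDomain_apply hinj m 1
  have h₁ : Finsupp.mapDomain (Equiv.swap (0 : Fin 2) 1) m 1 = m 0 :=
    Finsupp.mapDomain_apply hinj m 0
  rw [MvPolynomial.coeff_rename_mapDomain _ hinj, h₀, h₁]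
  ring

end BiHom

section Fiber

variable {K L : Type*} [Field K] [Field L] [Algebra K L]

theorem biHomEval_eq_mul_aeval (p : Poly2 K) {x y : L × L} (hx : x.1 ≠ 0) (hy : y.1 ≠ 0) :
    biHomEval p x y = x.1 ^ p.degreeOf 0 * y.1 ^ p.degreeOf 1 *
      MvPolynomial.aeval ![x.2 / x.1, y.2 / y.1] p := by
  rw [← biHomEval_one_one, ← biHomEval_smul_smul]
  congr 1 <;> ext <;> simp [mul_div_cancel₀, hx, hy]

theorem not_dvd_X_sub_C {p : Poly2 K} (hpy : 0 < p.degreeOf 1) (s : K) :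
    ¬ p ∣ MvPolynomial.X 0 - MvPolynomial.C s := by
  rintro ⟨q, hq⟩
  have hdeg : (MvPolynomial.X 0 - MvPolynomial.C s : Poly2 K).degreeOf 1 = 0 := by
    have h := MvPolynomial.degreeOf_sub_le (1 : Fin 2) (MvPolynomial.X 0 : Poly2 K)
      (MvPolynomial.C s)
    simpa [MvPolynomial.degreeOf_X_of_ne] using h
  have hne : (MvPolynomial.X 0 - MvPolynomial.C s : Poly2 K) ≠ 0 := by
    intro h
    have heval := congrArg (MvPolynomial.aeval fun _ => s + 1) h
    simp at heval
  rw [hq] at hne hdeg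
  rw [MvPolynomial.degreeOf_mul_eq (left_ne_zero_of_mul hne) (right_ne_zero_of_mul hne)] at hdeg
  omega

theorem aeval_algebraMap_ne_zero {p : Poly2 K} (hp : Irreducible p) (hpx : 0 < p.degreeOf 0)
    (hpy : 0 < p.degreeOf 1) (s : K) {b : L} (hb : Transcendental K b) :
    MvPolynomial.aeval ![algebraMap K L s, b] p ≠ 0 := fun h =>
  aeval_ne_zero_of_not_dvd hp hpx hb h (not_dvd_X_sub_C hpy s) (by simp)

theorem biHomEval_zero_C_ne_zero {p : Poly2 K} (hp : p ≠ 0) {d : K} (hd : d ≠ 0) :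
    biHomEval p ((0, Polynomial.C d) : Polynomial K × Polynomial K) (1, Polynomial.X) ≠ 0 := by
  -- Only the monomials of maximal degree in `x` survive, and no two of them agree in the degree
  -- in `y`.
  obtain ⟨m, hm, hmax⟩ := Finset.exists_mem_eq_sup p.support
    (MvPolynomial.support_nonempty.mpr hp) (fun m => m 0)
  rw [← MvPolynomial.degreeOf_eq_sup] at hmax
  have hsum : biHomEval p ((0, Polynomial.C d) : Polynomial K × Polynomial K) (1, Polynomial.X) =
      ∑ m ∈ p.support, Polynomial.monomial (m 1)
        (p.coeff m * (0 ^ (p.degreeOf 0 - m 0) * d ^ m 0)) := by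
    refine Finset.sum_congr rfl fun m _ => ?_
    simp [← Polynomial.C_mul_X_pow_eq_monomial, Polynomial.algebraMap_eq]
  intro h
  have hcoeff := congrArg (Polynomial.coeff · (m 1)) (hsum.symm.trans h)
  simp only [Polynomial.finsetSum_coeff, Polynomial.coeff_monomial, Polynomial.coeff_zero]
    at hcoeff
  rw [Finset.sum_eq_single_of_mem m hm] at hcoeff
  · simp [hmax, hd, MvPolynomial.mem_support_iff.mp hm] at hcoeff
  · intro m' hm' hne
    rcases (MvPolynomial.monomial_le_degreeOf 0 hm').lt_or_eq with hlt | heq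
    · simp [zero_pow (Nat.sub_pos_of_lt hlt).ne']
    · refine if_neg fun h₁ => hne <| Finsupp.ext ?_
      exact Fin.forall_fin_two.mpr ⟨heq.trans hmax, h₁⟩

theorem biHomEval_algebraMap_left_ne_zero {p : Poly2 K} (hp : Irreducible p)
    (hpx : 0 < p.degreeOf 0) (hpy : 0 < p.degreeOf 1) {c d : K} (hcd : (c, d) ≠ 0) {y : L × L}
    (hy : y.1 ≠ 0) (hb : Transcendental K (y.2 / y.1)) :
    biHomEval p (algebraMap K L c, algebraMap K L d) y ≠ 0 := by
  rcases eq_or_ne c 0 with rfl | hc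
  · have hd : d ≠ 0 := fun h => hcd (by rw [h]; rfl)
    have hmap := map_biHomEval (φ := (Polynomial.aeval (R := K) (y.2 / y.1)).toRingHom)
      (fun c => by simp) p (0, Polynomial.C d) (1, Polynomial.X)
    have hscale := biHomEval_smul_smul p 1 y.1 (algebraMap K L 0, algebraMap K L d) (1, y.2 / y.1)
    rw [Prod.smul_mk y.1, smul_eq_mul, smul_eq_mul, mul_one, mul_div_cancel₀ _ hy, one_smul]
      at hscale
    rw [hscale]
    refine mul_ne_zero (by simp [hy]) ?_
    convert (transcendental_iff.mp hb _).mt (biHomEval_zero_C_ne_zero hp.ne_zero hd) using 2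
    simpa using hmap.symm
  · have hc' : algebraMap K L c ≠ 0 := by simpa using hc
    rw [biHomEval_eq_mul_aeval p hc' hy, ← map_div₀]
    exact mul_ne_zero (mul_ne_zero (pow_ne_zero _ hc') (pow_ne_zero _ hy))
      (aeval_algebraMap_ne_zero hp hpx hpy _ hb)

theorem biHomEval_algebraMap_right_ne_zero {p : Poly2 K} (hp : Irreducible p)
    (hpx : 0 < p.degreeOf 0) (hpy : 0 < p.degreeOf 1) {c d : K} (hcd : (c, d) ≠ 0) {x : L × L}
    (hx : x.1 ≠ 0) (ha : Transcendental K (x.2 / x.1)) :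
    biHomEval p x (algebraMap K L c, algebraMap K L d) ≠ 0 := by
  rw [← biHomEval_swapVars]
  exact biHomEval_algebraMap_left_ne_zero (irreducible_swapVars hp)
    (by rwa [degreeOf_zero_swapVars]) (by rwa [degreeOf_one_swapVars]) hcd hx ha

end Fiber

section LocalEquation

variable {K R : Type*} [Field K] [CommRing R] [Algebra K R]

/-- Homogeneous coordinates `(x₀, x₁)` of the image of `1 / t` under the Möbius transformation with
matrix `A`. They make sense at `t = 0` too, where they represent the point `A • ∞`. -/
def moebiusHom (A : GL (Fin 2) K) (t : R) : R × R :=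
  (algebraMap K R (A 1 0) + algebraMap K R (A 1 1) * t,
    algebraMap K R (A 0 0) + algebraMap K R (A 0 1) * t)

/-- The equation, in the coordinates `s = 1 / x` and `t = 1 / y`, of the preimage under the pair of
Möbius transformations with matrices `A` and `B` of the curve associated with `p`: a local equation
of the curve at the point `(A • ∞, B • ∞)`. -/
def localEq (p : Poly2 K) (A B : GL (Fin 2) K) (s t : R) : R :=
  biHomEval p (moebiusHom A s) (moebiusHom B t)

theorem map_localEq {S : Type*} [CommRing S] [Algebra K S] {φ : R →+* S}
    (hφ : ∀ c, φ (algebraMap K R c) = algebraMap K S c) (p : Poly2 K) (A B : GL (Fin 2) K)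
    (s t : R) : φ (localEq p A B s t) = localEq p A B (φ s) (φ t) := by
  rw [localEq, map_biHomEval hφ]
  simp [localEq, moebiusHom, hφ]

theorem moebiusHom_zero (A : GL (Fin 2) K) :
    moebiusHom A (0 : R) = (algebraMap K R (A 1 0), algebraMap K R (A 0 0)) := by
  simp [moebiusHom]

theorem first_column_ne_zero (A : GL (Fin 2) K) : (A 1 0, A 0 0) ≠ 0 := by
  intro h
  obtain ⟨h₁, h₀⟩ := Prod.mk_eq_zero.mp h
  exact A.det_ne_zero (by rw [Matrix.det_fin_two, h₀, h₁, zero_mul, mul_zero, sub_zero])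

theorem exists_moebiusHom_zero_eq_smul_homCoord [DecidableEq K] (A : GL (Fin 2) K) :
    ∃ c : K, moebiusHom A (0 : K) = c • homCoord (A • ∞) := by
  rw [moebiusHom_zero, smul_infty_eq_ite]
  split_ifs with h
  · exact ⟨A 0 0, by simp [homCoord, h]⟩
  · exact ⟨A 1 0, by simp [homCoord, mul_div_cancel₀ _ h]⟩

theorem localEq_zero_zero_of_onCurve [DecidableEq K] {p : Poly2 K} {A B : GL (Fin 2) K}
    (hs : OnCurve p (A • ∞) (B • ∞)) : localEq p A B (0 : K) 0 = 0 := by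
  obtain ⟨c, hc⟩ := exists_moebiusHom_zero_eq_smul_homCoord A
  obtain ⟨d, hd⟩ := exists_moebiusHom_zero_eq_smul_homCoord B
  rw [localEq, hc, hd, biHomEval_smul_smul]
  exact mul_eq_zero_of_right _ hs

variable {L Γ₀ : Type*} [Field L] [Algebra K L] [LinearOrderedCommGroupWithZero Γ₀]
  {v : Valuation L Γ₀} [v.IsTrivialOn K] {z w : L}

theorem moebiusHom_inv_fst_ne_zero (hz : 1 < v z) (A : GL (Fin 2) K) :
    (moebiusHom A z⁻¹).1 ≠ 0 := by
  have hz₀ : z ≠ 0 := v.ne_zero_iff.mp (zero_lt_one.trans hz).ne'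
  have h := mul_ne_zero (moebius_denom_ne_zero hz A) (inv_ne_zero hz₀)
  rwa [add_mul, mul_assoc, mul_inv_cancel₀ hz₀, mul_one] at h

theorem moebiusHom_inv_snd_div_fst (hz : z ≠ 0) (A : GL (Fin 2) K) :
    (moebiusHom A z⁻¹).2 / (moebiusHom A z⁻¹).1 = moebius A z := by
  symm
  rw [moebius, ← mul_div_mul_right _ _ (inv_ne_zero hz), add_mul, add_mul, mul_assoc, mul_assoc,
    mul_inv_cancel₀ hz, mul_one, mul_one, moebiusHom]

theorem transcendental_moebiusHom_inv (hz : 1 < v z) (A : GL (Fin 2) K) :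
    Transcendental K ((moebiusHom A z⁻¹).2 / (moebiusHom A z⁻¹).1) := by
  rw [moebiusHom_inv_snd_div_fst (v.ne_zero_iff.mp (zero_lt_one.trans hz).ne')]
  exact transcendental_moebius hz A

theorem localEq_inv_inv_eq_zero_iff (hz : 1 < v z) (hw : 1 < v w) (p : Poly2 K)
    (A B : GL (Fin 2) K) : localEq p A B z⁻¹ w⁻¹ = 0 ↔
      MvPolynomial.aeval ![moebius A z, moebius B w] p = 0 := by
  have hA := moebiusHom_inv_fst_ne_zero hz A
  have hB := moebiusHom_inv_fst_ne_zero hw B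
  rw [localEq, biHomEval_eq_mul_aeval p hA hB, mul_eq_zero_iff_left (by simp [hA, hB]),
    moebiusHom_inv_snd_div_fst (v.ne_zero_iff.mp (zero_lt_one.trans hz).ne'),
    moebiusHom_inv_snd_div_fst (v.ne_zero_iff.mp (zero_lt_one.trans hw).ne')]

variable {p : Poly2 K} (hp : Irreducible p) (hpx : 0 < p.degreeOf 0) (hpy : 0 < p.degreeOf 1)
include hp hpx hpy

theorem localEq_zero_inv_ne_zero (hw : 1 < v w) (A B : GL (Fin 2) K) :
    localEq p A B 0 w⁻¹ ≠ 0 := by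
  rw [localEq, moebiusHom_zero]
  exact biHomEval_algebraMap_left_ne_zero hp hpx hpy (first_column_ne_zero A)
    (moebiusHom_inv_fst_ne_zero hw B) (transcendental_moebiusHom_inv hw B)

theorem localEq_inv_zero_ne_zero (hz : 1 < v z) (A B : GL (Fin 2) K) :
    localEq p A B z⁻¹ 0 ≠ 0 := by
  rw [localEq, moebiusHom_zero]
  exact biHomEval_algebraMap_right_ne_zero hp hpx hpy (first_column_ne_zero B)
    (moebiusHom_inv_fst_ne_zero hz A) (transcendental_moebiusHom_inv hz A)

end LocalEquation

section Branch

open scoped PowerSeries LaurentSeries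

variable {K : Type*} [Field K]

theorem one_lt_degVal_xSer : 1 < degVal K (xSer K) := by
  rw [one_lt_degVal_iff, degSer_xSer]
  exact one_pos

theorem exists_powerSeries_localEq_eq_zero [IsAlgClosed K] [CharZero K] {p : Poly2 K}
    (hp : Irreducible p) (hpx : 0 < p.degreeOf 0) (hpy : 0 < p.degreeOf 1) {A B : GL (Fin 2) K}
    (h₀ : localEq p A B (0 : K) 0 = 0) :
    ∃ N ≠ 0, ∃ w : K⟦X⟧, PowerSeries.constantCoeff w = 0 ∧
      localEq p A B (PowerSeries.X ^ N : K⟦X⟧) w = 0 := by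
  let F : Polynomial K⟦X⟧ := localEq p A B (Polynomial.C PowerSeries.X) Polynomial.X
  have hred : F.map PowerSeries.constantCoeff = localEq p A B 0 Polynomial.X := by
    rw [← Polynomial.coe_mapRingHom, map_localEq fun c => by simp [Polynomial.algebraMap_apply]]
    simp
  have hF : F.map PowerSeries.constantCoeff ≠ 0 := by
    intro h
    refine localEq_zero_inv_ne_zero hp hpx hpy (one_lt_degVal_xSer (K := K)) A B ?_
    have heval := map_localEq (φ := (Polynomial.aeval (R := K) (xSer K)⁻¹).toRingHom)
      (fun c => by simp) p A B (0 : Polynomial K) Polynomial.X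
    simpa [← hred, h] using heval.symm
  have hF₀ : PowerSeries.constantCoeff (F.coeff 0) = 0 := by
    rw [← Polynomial.coeff_map, Polynomial.coeff_zero_eq_eval_zero, hred,
      ← Polynomial.coe_evalRingHom, map_localEq fun c => by simp]
    simpa using h₀
  obtain ⟨N, hN, w, hw, hroot⟩ := hasPuiseuxRoot_of_constantCoeff_coeff_zero hF hF₀
  refine ⟨N, hN, w, hw, ?_⟩
  rw [Polynomial.IsRoot, ← Polynomial.coe_mapRingHom, ← Polynomial.coe_evalRingHom,
    ← RingHom.comp_apply, map_localEq fun c => by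
      simp [Polynomial.algebraMap_apply, PowerSeries.expand_C]]
    at hroot
  simpa using hroot

/-- The embedding `f(X) ↦ f(t ^ (1 / N))` of the field of Laurent series into that of Hahn series
with rational exponents. -/
def toPuiseux (N : ℕ) (hN : N ≠ 0) : K⸨X⸩ →+* HahnSeries ℚ K :=
  have hN' : (0 : ℚ) < (N : ℚ)⁻¹ := by positivity
  HahnSeries.embDomainRingHom ((AddMonoidHom.mulRight (N : ℚ)⁻¹).comp (Int.castAddHom ℚ))
    ((mul_left_injective₀ hN'.ne').comp Int.cast_injective)
    fun _ _ => (mul_le_mul_iff_of_pos_right hN').trans Int.cast_le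

theorem isPuiseux_toPuiseux (N : ℕ) (hN : N ≠ 0) (u : K⸨X⸩) : IsPuiseux (toPuiseux N hN u) := by
  refine ⟨N, Nat.pos_of_ne_zero hN, fun a ha => ?_⟩
  obtain ⟨m, -, rfl⟩ := HahnSeries.support_embDomain_subset ha
  exact ⟨m, inv_mul_cancel_right₀ (Nat.cast_ne_zero.mpr hN) (m : ℚ)⟩

theorem order_toPuiseux (N : ℕ) (hN : N ≠ 0) (u : K⸨X⸩) :
    (toPuiseux N hN u).order = u.order * (N : ℚ)⁻¹ := by
  rcases eq_or_ne u 0 with rfl | hu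
  · simp
  · have h : (toPuiseux N hN u).orderTop = WithTop.map _ u.orderTop :=
      HahnSeries.orderTop_embDomain
    rw [← HahnSeries.order_eq_orderTop_of_ne_zero hu, ← HahnSeries.order_eq_orderTop_of_ne_zero
      ((map_ne_zero _).mpr hu)] at h
    exact WithTop.coe_injective h

theorem toPuiseux_C (N : ℕ) (hN : N ≠ 0) (c : K) :
    toPuiseux N hN (HahnSeries.C c) = HahnSeries.C c :=
  HahnSeries.embDomainRingHom_C

theorem toPuiseux_X_pow (N : ℕ) (hN : N ≠ 0) :
    toPuiseux N hN (HahnSeries.ofPowerSeries ℤ K (PowerSeries.X ^ N)) = (xSer K)⁻¹ := by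
  rw [HahnSeries.ofPowerSeries_X_pow, xSer, HahnSeries.inv_single, neg_neg, inv_one]
  refine HahnSeries.embDomain_single.trans ?_
  refine congrArg (HahnSeries.single · 1) ?_
  change ((N : ℤ) : ℚ) * (N : ℚ)⁻¹ = 1
  rw [Int.cast_natCast, mul_inv_cancel₀ (Nat.cast_ne_zero.mpr hN)]

theorem order_ofPowerSeries_pos {w : K⟦X⟧} (hw₀ : w ≠ 0) (hw : PowerSeries.constantCoeff w = 0) :
    0 < (HahnSeries.ofPowerSeries ℤ K w).order := by
  have hne : HahnSeries.ofPowerSeries ℤ K w ≠ 0 :=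
    (map_ne_zero_iff _ HahnSeries.ofPowerSeries_injective).mpr hw₀
  by_contra! hle
  have hcoeff := mt HahnSeries.coeff_order_eq_zero.mp hne
  rw [PowerSeries.coeff_coe] at hcoeff
  rcases hle.lt_or_eq with hlt | heq
  · exact hcoeff (if_pos hlt)
  · simp [heq, hw] at hcoeff

end Branch

section BranchAtPoint

open scoped PowerSeries

variable {K : Type*} [Field K]

theorem moebius_xx_mem_evalGraph {φ : HahnSeries ℚ K} (A : GL (Fin 2) K) :
    (moebius A (xx K), moebius A (xSer K)) ∈
      evalGraph (Rat2 K) (MvPolynomial.aeval (R := K) ![xSer K, φ]) :=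
  moebius_mem_evalGraph (xx_mem_evalGraph _ _) A (moebius_denom_ne_zero one_lt_degVal_xSer A)

theorem moebius_yy_mem_evalGraph {φ : HahnSeries ℚ K} (hφ : 0 < degSer φ) (B : GL (Fin 2) K) :
    (moebius B (yy K), moebius B φ) ∈
      evalGraph (Rat2 K) (MvPolynomial.aeval (R := K) ![xSer K, φ]) :=
  moebius_mem_evalGraph (yy_mem_evalGraph _ _) B
    (moebius_denom_ne_zero (one_lt_degVal_iff.mpr hφ) B)

theorem aeval_transPoly_eq_zero_iff (A B : GL (Fin 2) K) (p : Poly2 K) {φ : HahnSeries ℚ K}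
    (hφ : 0 < degSer φ) : MvPolynomial.aeval ![xSer K, φ] (transPoly A B p) = 0 ↔
      MvPolynomial.aeval ![moebius A⁻¹ (xSer K), moebius B⁻¹ φ] p = 0 := by
  have hmem := aeval_pair_mem_evalGraph (moebius_xx_mem_evalGraph A⁻¹)
    (moebius_yy_mem_evalGraph hφ B⁻¹) p
  rw [← evalRat_eq_of_mem_evalGraph hmem, evalRat, div_eq_zero_iff, transPoly,
    or_iff_left]
  exact den_ne_zero_of_mem_evalGraph hmem

theorem exists_isPuiseux_localEq_eq_zero [IsAlgClosed K] [CharZero K] {p : Poly2 K}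
    (hp : Irreducible p) (hpx : 0 < p.degreeOf 0) (hpy : 0 < p.degreeOf 1) {A B : GL (Fin 2) K}
    (h₀ : localEq p A B (0 : K) 0 = 0) :
    ∃ φ : HahnSeries ℚ K, IsPuiseux φ ∧ 0 < degSer φ ∧ localEq p A B (xSer K)⁻¹ φ⁻¹ = 0 := by
  obtain ⟨N, hN, w, hw, hroot⟩ := exists_powerSeries_localEq_eq_zero hp hpx hpy h₀
  let θ := (toPuiseux N hN).comp (HahnSeries.ofPowerSeries ℤ K)
  have hθ (c : K) : θ (algebraMap K K⟦X⟧ c) = algebraMap K (HahnSeries ℚ K) c := by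
    rw [algebraMap_hahnSeries, ← toPuiseux_C N hN, ← HahnSeries.ofPowerSeries_C]
    rfl
  have hθroot : localEq p A B (xSer K)⁻¹ (θ w) = 0 := by
    have h := congrArg θ hroot
    rwa [map_zero, map_localEq hθ,
      RingHom.comp_apply, toPuiseux_X_pow] at h
  have hw₀ : w ≠ 0 := by
    rintro rfl
    rw [map_zero] at hθroot
    exact localEq_inv_zero_ne_zero hp hpx hpy (one_lt_degVal_xSer (K := K)) A B hθroot
  refine ⟨(θ w)⁻¹, ?_, ?_, by rwa [inv_inv]⟩
  · rw [RingHom.comp_apply, ← map_inv₀]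
    exact isPuiseux_toPuiseux N hN _
  · rw [degSer_inv, degSer, neg_neg, RingHom.comp_apply, order_toPuiseux]
    have hw_pos := order_ofPowerSeries_pos hw₀ hw
    positivity

theorem exists_branch [DecidableEq K] [IsAlgClosed K] [CharZero K] {p : Poly2 K}
    (hp : Irreducible p) (hpx : 0 < p.degreeOf 0) (hpy : 0 < p.degreeOf 1) {s₁ s₂ : OnePoint K}
    (hs : OnCurve p s₁ s₂) {A B : GL (Fin 2) K} (hA : A • s₁ = ∞) (hB : B • s₂ = ∞) :
    ∃ φ : HahnSeries ℚ K, IsBranch (transPoly A B p) φ := by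
  rw [eq_inv_smul_iff.mpr hA, eq_inv_smul_iff.mpr hB] at hs
  obtain ⟨φ, hφ, hdeg, hroot⟩ :=
    exists_isPuiseux_localEq_eq_zero hp hpx hpy (localEq_zero_zero_of_onCurve hs)
  refine ⟨φ, hφ, (aeval_transPoly_eq_zero_iff A B p hdeg).mpr ?_, hdeg⟩
  exact (localEq_inv_inv_eq_zero_iff one_lt_degVal_xSer (one_lt_degVal_iff.mpr hdeg) p _ _).mp hroot

theorem exists_smul_eq_infty [DecidableEq K] (s : OnePoint K) :
    ∃ A : GL (Fin 2) K, A • s = ∞ := by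
  cases s with
  | infty => exact ⟨1, one_smul _ _⟩
  | coe a =>
    refine ⟨Matrix.GeneralLinearGroup.mkOfDetNeZero !![0, 1; 1, -a] (by simp), ?_⟩
    rw [smul_some_eq_ite, if_pos]
    simp [Matrix.GeneralLinearGroup.mkOfDetNeZero]

end BranchAtPoint

section Poles

variable {K : Type*} [Field K] {p : Poly2 K} (hp : Irreducible p) (hpx : 0 < p.degreeOf 0)
  {r : Rat2 K} (hr : InLocalRing p r) {f g : RatFunc K} (hfg : (f, g) ∈ sepSet r p)
  {A B : GL (Fin 2) K} {φ : HahnSeries ℚ K} (hφ : IsBranch (transPoly A B p) φ)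
include hp hpx hr hfg hφ

theorem evalRat_transRat_eq_sub : evalRat (xSer K) φ (transRat A B r) =
    f.eval (algebraMap K _) (moebius A⁻¹ (xSer K)) -
      g.eval (algebraMap K _) (moebius B⁻¹ φ) := by
  obtain ⟨-, hroot, hdeg⟩ := hφ
  rw [aeval_transPoly_eq_zero_iff A B p hdeg] at hroot
  have hb := transcendental_moebius (one_lt_degVal_iff.mpr hdeg) B⁻¹
  rw [← evalRat_eq_sub_of_mem_sepSet hp hpx hr hfg
    (transcendental_moebius one_lt_degVal_xSer A⁻¹) hb hroot]
  exact evalRat_eq_of_mem_evalGraph (evalRat_mem_evalGraph (moebius_xx_mem_evalGraph A⁻¹)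
    (moebius_yy_mem_evalGraph hdeg B⁻¹) (aeval_ne_zero_of_not_dvd hp hpx hb hroot hr))

variable [DecidableEq K] {s₁ s₂ : OnePoint K} (hA : A • s₁ = ∞) (hB : B • s₂ = ∞)
include hA hB

theorem exists_evalRat_transRat_eq_sub : ∃ u v : HahnSeries ℚ K,
    evalRat (xSer K) φ (transRat A B r) = u - v ∧
      degSer u = mult s₁ f ∧ degSer v = mult s₂ g * degSer φ := by
  refine ⟨_, _, evalRat_transRat_eq_sub hp hpx hr hfg hφ, ?_, ?_⟩
  · rw [degSer_eval_moebius (degSer_xSer.trans_gt one_pos), ← eq_inv_smul_iff.mpr hA, degSer_xSer,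
      mul_one]
  · rw [degSer_eval_moebius hφ.2.2, ← eq_inv_smul_iff.mpr hB]

theorem isPole_or_isPole_of_degSer_pos (h : 0 < degSer (evalRat (xSer K) φ (transRat A B r))) :
    IsPole s₁ f ∨ IsPole s₂ g := by
  obtain ⟨u, v, huv, hu, hv⟩ := exists_evalRat_transRat_eq_sub hp hpx hr hfg hφ hA hB
  rw [huv] at h
  have hpos := degSer_pos_or_pos_of_sub_pos h
  rwa [hu, hv, mul_pos_iff_of_pos_right hφ.2.2, Int.cast_pos, Int.cast_pos] at hpos

theorem mult_left_eq_degSer (hf : IsPole s₁ f) (hg : ¬ IsPole s₂ g) :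
    (mult s₁ f : ℚ) = degSer (evalRat (xSer K) φ (transRat A B r)) := by
  obtain ⟨u, v, huv, hu, hv⟩ := exists_evalRat_transRat_eq_sub hp hpx hr hfg hφ hA hB
  have hu_pos : 0 < degSer u := by rwa [hu, Int.cast_pos]
  have hv_nonpos : ¬ 0 < degSer v := by
    rwa [hv, mul_pos_iff_of_pos_right hφ.2.2, Int.cast_pos]
  rw [huv, degSer_sub_of_lt hu_pos ((not_lt.mp hv_nonpos).trans_lt hu_pos), hu]

theorem mult_right_eq_degSer_div (hg : IsPole s₂ g) (hf : ¬ IsPole s₁ f) :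
    (mult s₂ g : ℚ) = degSer (evalRat (xSer K) φ (transRat A B r)) / degSer φ := by
  obtain ⟨u, v, huv, hu, hv⟩ := exists_evalRat_transRat_eq_sub hp hpx hr hfg hφ hA hB
  have hu_nonpos : ¬ 0 < degSer u := by rwa [hu, Int.cast_pos]
  have hv_pos : 0 < degSer v := by rwa [hv, mul_pos_iff_of_pos_right hφ.2.2, Int.cast_pos]
  rw [huv, degSer_sub_swap, degSer_sub_of_lt hv_pos ((not_lt.mp hu_nonpos).trans_lt hv_pos), hv,
    mul_div_cancel_right₀ _ hφ.2.2.ne']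

theorem mult_left_eq_mult_right_mul (h : ¬ 0 < degSer (evalRat (xSer K) φ (transRat A B r)))
    (hpole : IsPole s₁ f ∨ IsPole s₂ g) : (mult s₁ f : ℚ) = mult s₂ g * degSer φ := by
  obtain ⟨u, v, huv, hu, hv⟩ := exists_evalRat_transRat_eq_sub hp hpx hr hfg hφ hA hB
  rw [huv] at h
  rw [← hu, ← hv]
  apply degSer_eq_of_sub_not_pos h
  rwa [hu, hv, mul_pos_iff_of_pos_right hφ.2.2, Int.cast_pos, Int.cast_pos]

theorem isPole_iff_isPole (h : ¬ 0 < degSer (evalRat (xSer K) φ (transRat A B r))) :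
    IsPole s₁ f ↔ IsPole s₂ g := by
  have hpos : (0 : ℚ) < mult s₂ g * degSer φ ↔ IsPole s₂ g := by
    rw [mul_pos_iff_of_pos_right hφ.2.2, Int.cast_pos, IsPole]
  have hmult := mult_left_eq_mult_right_mul hp hpx hr hfg hφ hA hB h
  rw [← hpos, IsPole, ← Int.cast_pos (R := ℚ)]
  constructor <;> intro hpole
  · rwa [← hmult (Or.inl (Int.cast_pos.mp hpole))]
  · rwa [hmult (Or.inr (hpos.mp hpole))]

end Poles

end

end SepCurve

theorem mainTheorem3 {K : Type*} [Field K] [DecidableEq K] [IsAlgClosed K] [CharZero K]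
    (p : Poly2 K) (hp : Irreducible p)
    (hpx : 0 < p.degreeOf 0) (hpy : 0 < p.degreeOf 1)
    (r : Rat2 K) (hr : InLocalRing p r)
    (f g : RatFunc K) (hfg : (f, g) ∈ sepSet r p)
    (s₁ s₂ : OnePoint K) (hs : OnCurve p s₁ s₂) :
    -- a pole of `r` has a coordinate that is a pole of `f` or `g`
    (IsPoleOnCurve p r s₁ s₂ → IsPole s₁ f ∨ IsPole s₂ g) ∧
    -- after moving the point to `(∞, ∞)` there is a branch to read off the local behavior from
    (∀ A B : GL (Fin 2) K, A • s₁ = ∞ → B • s₂ = ∞ →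
      ∃ φ : HahnSeries ℚ K, IsBranch (transPoly A B p) φ) ∧
    -- if exactly one coordinate is a pole, its multiplicity can be read off from any branch
    (∀ A B : GL (Fin 2) K, A • s₁ = ∞ → B • s₂ = ∞ →
      ∀ φ : HahnSeries ℚ K, IsBranch (transPoly A B p) φ →
        (IsPole s₁ f → ¬ IsPole s₂ g →
          (mult s₁ f : ℚ) = degSer (evalRat (xSer K) φ (transRat A B r))) ∧
        (IsPole s₂ g → ¬ IsPole s₁ f →
          (mult s₂ g : ℚ) = degSer (evalRat (xSer K) φ (transRat A B r)) / degSer φ)) ∧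
    -- at a point that is not a pole of `r`, poles propagate ...
    (¬ IsPoleOnCurve p r s₁ s₂ → (IsPole s₁ f ↔ IsPole s₂ g)) ∧
    -- ... with a ratio of multiplicities that can be read off from any branch
    (¬ IsPoleOnCurve p r s₁ s₂ → IsPole s₁ f → IsPole s₂ g →
      ∀ A B : GL (Fin 2) K, A • s₁ = ∞ → B • s₂ = ∞ →
        ∀ φ : HahnSeries ℚ K, IsBranch (transPoly A B p) φ →
          (mult s₂ g : ℚ) = (mult s₁ f : ℚ) / degSer φ) := by
  refine ⟨?_, fun A B hA hB => exists_branch hp hpx hpy hs hA hB,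
    fun A B hA hB φ hφ => ⟨?_, ?_⟩, fun hnot => ?_, fun hnot hf _ A B hA hB φ hφ => ?_⟩
  · rintro ⟨A, B, hA, hB, φ, hφ, hpos⟩
    exact isPole_or_isPole_of_degSer_pos hp hpx hr hfg hφ hA hB hpos
  · exact mult_left_eq_degSer hp hpx hr hfg hφ hA hB
  · exact mult_right_eq_degSer_div hp hpx hr hfg hφ hA hB
  · obtain ⟨A, hA⟩ := exists_smul_eq_infty s₁
    obtain ⟨B, hB⟩ := exists_smul_eq_infty s₂
    obtain ⟨φ, hφ⟩ := exists_branch hp hpx hpy hs hA hB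
    exact isPole_iff_isPole hp hpx hr hfg hφ hA hB fun h => hnot ⟨A, B, hA, hB, φ, hφ, h⟩
  · rw [eq_div_iff hφ.2.2.ne']
    exact (mult_left_eq_mult_right_mul hp hpx hr hfg hφ hA hB
      (fun h => hnot ⟨A, B, hA, hB, φ, hφ, h⟩) (Or.inl hf)).symm
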